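/- A commutative ring $A$ is called Tor-persistent if every finitely generated $A$-module $M$ with $\operatorname{Tor}^A_i(M,M)=0$ for all $i\gg 0$ has finite projective dimension over $A$. Let $(R,\mathfrak m)$ be a commutative noetherian local ring and let $x_1,\dots,x_n$ be an $R$-regular sequence. If $R/(x_1,\dots,x_n)$ is Tor-persistent, then $R$ is Tor-persistent. Conversely, if $x_i\notin \mathfrak m^2+(x_1,\dots,x_{i-1})$ for every $i=1,\dots,n$ and $R$ is Tor-persistent, then $R/(x_1,\dots,x_n)$ is Tor-persistent. -/

import Mathlib

open CategoryTheory

universe u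

/-- A commutative ring `A` is Tor-persistent if every finitely generated `A`-module `M` with
`Tor^A_i(M, M) = 0` for all `i ≫ 0` has finite projective dimension. -/
def IsTorPersistent (A : Type u) [CommRing A] : Prop :=
  ∀ M : ModuleCat.{u} A, Module.Finite A M →
    (∃ N : ℕ, ∀ i : ℕ, N ≤ i → Limits.IsZero (((Tor (ModuleCat.{u} A) i).obj M).obj M)) →
    ∃ d : ℕ, HasProjectiveDimensionLE M d

/-! Since $(R/x_1)/(x_2,\dots,x_n)\cong R/(x_1,\dots,x_n)$, induction on $n$ reduces everything to
one regular element $x$; put $S=R/x$.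

Ascent (`IsTorPersistent.of_quotient_span_singleton`): replace $M$ by a first syzygy $K$, on which
$x$ is regular. Then $\operatorname{Tor}^S(K/xK,K/xK)=\operatorname{Tor}^R(K/xK,K)$ vanishes
eventually by $0\to K\xrightarrow{x}K\to K/xK\to0$, so $K/xK$ has finite projective dimension over
$S$, and hence so has $K$ over $R$.

Descent (`IsTorPersistent.quotient_span_singleton`): for an $S$-module $M$ with $R$-syzygy $K$ there
is an exact sequence $0\to M\to K/xK\to\Omega_S M\to0$, which carries vanishing of
$\operatorname{Tor}^S(M,M)$ to $\operatorname{Tor}^R(M,M)$. So $M$ has finite projective dimension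
over $R$; when $x\notin\mathfrak m^2$, this forces the same over $S$
(`hasFiniteProjectiveDimension_quotient`). -/

/-! ### Vanishing of Tor by dimension shifting -/

open TensorProduct in
theorem LinearMap.lTensor_injective_iff_rTensor_injective {R K P N K' P' M : Type*} [CommRing R]
    [AddCommGroup K] [AddCommGroup P] [AddCommGroup N] [AddCommGroup K'] [AddCommGroup P']
    [AddCommGroup M] [Module R K] [Module R P] [Module R N] [Module R K'] [Module R P'] [Module R M]
    [Module.Flat R P] [Module.Flat R P']
    {f : K →ₗ[R] P} {g : P →ₗ[R] N} {f' : K' →ₗ[R] P'} {g' : P' →ₗ[R] M}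
    (hf : Function.Injective f) (hfg : Function.Exact f g) (hg : Function.Surjective g)
    (hf' : Function.Injective f') (hfg' : Function.Exact f' g') (hg' : Function.Surjective g') :
    Function.Injective (f.lTensor M) ↔ Function.Injective (f'.rTensor N) := by
  constructor
  · intro h
    have := lTensor_injective_of_exact_of_exact_of_rTensor_injective hfg hg hfg' hg'
      (f₁ := f) (f₂ := g) (g₁ := f') (g₂ := g')
      (by rwa [← LinearMap.lTensor_inj_iff_rTensor_inj])
      (Module.Flat.lTensor_preserves_injective_linearMap _ hf')
    rwa [← LinearMap.lTensor_inj_iff_rTensor_inj]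
  · intro h
    exact lTensor_injective_of_exact_of_exact_of_rTensor_injective hfg' hg' hfg hg
      h (Module.Flat.lTensor_preserves_injective_linearMap _ hf)

/-- `f` and `g` form a short exact sequence `0 → K → P → N → 0` with `P` flat. -/
structure IsFlatPresentation {R K P N : Type*} [CommRing R] [AddCommGroup K] [AddCommGroup P]
    [AddCommGroup N] [Module R K] [Module R P] [Module R N] (f : K →ₗ[R] P) (g : P →ₗ[R] N) :
    Prop where
  flat : Module.Flat R P
  injective : Function.Injective f
  exact : Function.Exact f g
  surjective : Function.Surjective g

theorem isFlatPresentation_ker {R P N : Type*} [CommRing R] [AddCommGroup P]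
    [AddCommGroup N] [Module R P] [Module R N] [Module.Flat R P] {g : P →ₗ[R] N}
    (hg : Function.Surjective g) : IsFlatPresentation (LinearMap.ker g).subtype g :=
  ⟨inferInstance, Subtype.val_injective, LinearMap.exact_subtype_ker_map g, hg⟩

/-- The first syzygy of a module with respect to its tautological free cover. -/
noncomputable abbrev TautologicalSyzygy (R N : Type u) [CommRing R] [AddCommGroup N] [Module R N] :
    Submodule R (N →₀ R) :=
  LinearMap.ker (Finsupp.linearCombination R (id : N → N))

theorem isFlatPresentation_tautological (R N : Type u) [CommRing R] [AddCommGroup N]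
    [Module R N] : IsFlatPresentation (R := R) (K := TautologicalSyzygy R N)
      (P := N →₀ R) (N := N) (TautologicalSyzygy R N).subtype
      (Finsupp.linearCombination R (id : N → N)) :=
  isFlatPresentation_ker (Finsupp.linearCombination_id_surjective R N)

/-- `TorVanishes R M i N` expresses that `Tor_{i+1}(M, N) = 0`, by dimension shifting in `N`. -/
def TorVanishes (R : Type u) [CommRing R] (M : Type u) [AddCommGroup M] [Module R M] :
    ℕ → (N : Type u) → [AddCommGroup N] → [Module R N] → Prop
  | 0, N, _, _ => Function.Injective ((TautologicalSyzygy R N).subtype.lTensor M)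
  | i + 1, N, _, _ => TorVanishes R M i (TautologicalSyzygy R N)

namespace IsFlatPresentation

variable {R : Type u} [CommRing R] {K P N N' N'' K' P' M : Type u}
  [AddCommGroup K] [AddCommGroup P] [AddCommGroup N] [AddCommGroup K'] [AddCommGroup P']
  [AddCommGroup M] [Module R K] [Module R P] [Module R N] [Module R K'] [Module R P'] [Module R M]
  [AddCommGroup N'] [AddCommGroup N''] [Module R N'] [Module R N'']
  {f : K →ₗ[R] P} {g : P →ₗ[R] N} {f' : K' →ₗ[R] P'} {g' : P' →ₗ[R] M}

theorem lTensor_iff_rTensor (h : IsFlatPresentation f g) (h' : IsFlatPresentation f' g') :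
    Function.Injective (f.lTensor M) ↔ Function.Injective (f'.rTensor N) :=
  have := h.flat
  have := h'.flat
  LinearMap.lTensor_injective_iff_rTensor_injective h.injective h.exact h.surjective
    h'.injective h'.exact h'.surjective

theorem torVanishes_zero_iff_rTensor (N) [AddCommGroup N] [Module R N]
    (h' : IsFlatPresentation f' g') :
    TorVanishes R M 0 N ↔ Function.Injective (f'.rTensor N) :=
  (isFlatPresentation_tautological R N).lTensor_iff_rTensor h'

theorem torVanishes_zero_iff (M) [AddCommGroup M] [Module R M] (h : IsFlatPresentation f g) :
    TorVanishes R M 0 N ↔ Function.Injective (f.lTensor M) := by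
  rw [(isFlatPresentation_tautological R M).torVanishes_zero_iff_rTensor N,
    h.lTensor_iff_rTensor (isFlatPresentation_tautological R M)]

/-- Both sides say $\operatorname{Tor}_{i+2}(M,N)=0$. For $i=0$, flatness turns each into
injectivity of $K'\otimes K\to P'\otimes P$; the inductive step trades syzygies between the two
arguments. Independence of the presentation follows. -/
theorem torVanishes_kernel_comm (h : IsFlatPresentation f g) (h' : IsFlatPresentation f' g')
    (i : ℕ) : TorVanishes R M i K ↔ TorVanishes R K' i N := by
  induction i generalizing K P N K' P' M with
  | zero =>
    have := h.flat
    have := h'.flat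
    rw [h'.torVanishes_zero_iff_rTensor K, h.torVanishes_zero_iff K']
    have h1 : Function.Injective (f'.rTensor P) :=
      Module.Flat.rTensor_preserves_injective_linearMap _ h'.injective
    have h2 : Function.Injective (f.lTensor P') :=
      Module.Flat.lTensor_preserves_injective_linearMap _ h.injective
    rw [← h1.of_comp_iff, ← h2.of_comp_iff, ← LinearMap.coe_comp, ← LinearMap.coe_comp,
      LinearMap.lTensor_comp_rTensor, LinearMap.rTensor_comp_lTensor]
  | succ i ih =>
    have hK := isFlatPresentation_tautological R K
    have hN := isFlatPresentation_tautological R N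
    have hK' := isFlatPresentation_tautological R K'
    change TorVanishes R M i (TautologicalSyzygy R K) ↔
      TorVanishes R K' i (TautologicalSyzygy R N)
    exact (ih hK h').trans ((ih h hK').trans (ih hN hK').symm)

theorem torVanishes_succ_iff (M) [AddCommGroup M] [Module R M] (h : IsFlatPresentation f g)
    (i : ℕ) : TorVanishes R M (i + 1) N ↔ TorVanishes R M i K := by
  have hM := isFlatPresentation_tautological R M
  exact ((isFlatPresentation_tautological R N).torVanishes_kernel_comm hM i).trans
    (h.torVanishes_kernel_comm hM i).symm

theorem torVanishes_succ_iff_left (N) [AddCommGroup N] [Module R N]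
    (h' : IsFlatPresentation f' g') (i : ℕ) :
    TorVanishes R M (i + 1) N ↔ TorVanishes R K' i N :=
  (isFlatPresentation_tautological R N).torVanishes_kernel_comm h' i

theorem torVanishes_of_exact {a : N →ₗ[R] N'} {b : N' →ₗ[R] N''} (h' : IsFlatPresentation f' g')
    (ha : Function.Injective a) (hab : Function.Exact a b) (hb : Function.Surjective b)
    (h₁ : TorVanishes R M 0 N) (h₃ : TorVanishes R M 0 N'') : TorVanishes R M 0 N' := by
  have := h'.flat
  rw [h'.torVanishes_zero_iff_rTensor N] at h₁
  rw [h'.torVanishes_zero_iff_rTensor N''] at h₃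
  rw [h'.torVanishes_zero_iff_rTensor N', injective_iff_map_eq_zero]
  intro z hz
  have hb0 : b.lTensor K' z = 0 := by
    apply h₃
    rw [map_zero, ← LinearMap.comp_apply, LinearMap.rTensor_comp_lTensor,
      ← LinearMap.lTensor_comp_rTensor, LinearMap.comp_apply, hz, map_zero]
  obtain ⟨w, rfl⟩ := (lTensor_exact K' hab hb z).1 hb0
  have hP : Function.Injective (a.lTensor P') :=
    Module.Flat.lTensor_preserves_injective_linearMap _ ha
  have : w = 0 := by
    apply h₁
    apply hP
    rw [map_zero, map_zero, ← LinearMap.comp_apply, LinearMap.lTensor_comp_rTensor,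
      ← LinearMap.rTensor_comp_lTensor, LinearMap.comp_apply, hz]
  rw [this, map_zero]

theorem comp_equiv (h : IsFlatPresentation f g)
    (e : N ≃ₗ[R] N') : IsFlatPresentation f (e.toLinearMap ∘ₗ g) :=
  ⟨h.flat, h.injective, by
    rw [LinearMap.exact_iff, LinearEquiv.ker_comp, h.exact.linearMap_ker_eq],
    e.surjective.comp h.surjective⟩

end IsFlatPresentation

/-! ### Symmetry, short exact sequences and resolutions -/

section TorVanishes

variable {R : Type u} [CommRing R] {M N N' N'' : Type u} [AddCommGroup M] [AddCommGroup N]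
  [AddCommGroup N'] [AddCommGroup N''] [Module R M] [Module R N] [Module R N'] [Module R N'']

theorem torVanishes_comm (i : ℕ) : TorVanishes R M i N ↔ TorVanishes R N i M := by
  induction i generalizing M N with
  | zero =>
    have hM := isFlatPresentation_tautological R M
    rw [hM.torVanishes_zero_iff_rTensor N, hM.torVanishes_zero_iff N,
      LinearMap.lTensor_inj_iff_rTensor_inj]
  | succ i ih =>
    have hM := isFlatPresentation_tautological R M
    rw [hM.torVanishes_succ_iff_left N, hM.torVanishes_succ_iff N, ih]

theorem torVanishes_congr_right (e : N ≃ₗ[R] N') (i : ℕ) :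
    TorVanishes R M i N ↔ TorVanishes R M i N' := by
  have h := isFlatPresentation_tautological R N
  cases i with
  | zero => rw [h.torVanishes_zero_iff M, (h.comp_equiv e).torVanishes_zero_iff M]
  | succ i => rw [h.torVanishes_succ_iff M, (h.comp_equiv e).torVanishes_succ_iff M]

theorem torVanishes_of_flat_left [Module.Flat R M] (i : ℕ) : TorVanishes R M i N := by
  induction i generalizing N with
  | zero => exact Module.Flat.lTensor_preserves_injective_linearMap _ Subtype.val_injective
  | succ i ih => exact ih

theorem torVanishes_of_exact {a : N' →ₗ[R] N} {b : N →ₗ[R] N''} (ha : Function.Injective a)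
    (hab : Function.Exact a b) (hb : Function.Surjective b) {i : ℕ} (h' : TorVanishes R M i N')
    (h'' : TorVanishes R M i N'') : TorVanishes R M i N := by
  have hM := isFlatPresentation_tautological R M
  induction i generalizing M with
  | zero => exact hM.torVanishes_of_exact ha hab hb h' h''
  | succ i ih =>
    rw [hM.torVanishes_succ_iff_left N'] at h'
    rw [hM.torVanishes_succ_iff_left N''] at h''
    rw [hM.torVanishes_succ_iff_left N]
    exact ih h' h'' (isFlatPresentation_tautological R _)

/-- If `0 → N' → N → N'' → 0` is exact, `Tor_{i+1}(M, N') = 0` and `Tor_{i+2}(M, N) = 0`, then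
`Tor_{i+2}(M, N'') = 0`. -/
theorem torVanishes_succ_of_exact {a : N' →ₗ[R] N} {b : N →ₗ[R] N''}
    (ha : Function.Injective a) (hab : Function.Exact a b)
    (hb : Function.Surjective b) {i : ℕ} (h' : TorVanishes R M i N')
    (h : TorVanishes R M (i + 1) N) : TorVanishes R M (i + 1) N'' := by
  have hN := isFlatPresentation_tautological R N
  set g := Finsupp.linearCombination R (id : N → N)
  rw [hN.torVanishes_succ_iff M] at h
  -- The free cover of `N` also covers `N''`; its kernel there is an extension of `N'` by the syzygy
  -- of `N`.
  rw [(isFlatPresentation_ker (g := b ∘ₗ g) (hb.comp hN.surjective)).torVanishes_succ_iff M]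
  have hmem (z : LinearMap.ker (b ∘ₗ g)) : g z ∈ LinearMap.range a :=
    (hab _).1 z.2
  let q : LinearMap.ker (b ∘ₗ g) →ₗ[R] N' :=
    (LinearEquiv.ofInjective a ha).symm.toLinearMap ∘ₗ
      (g.domRestrict _).codRestrict (LinearMap.range a) hmem
  have hq (z) : a (q z) = g z :=
    congrArg Subtype.val ((LinearEquiv.ofInjective a ha).apply_symm_apply ⟨g z, hmem z⟩)
  let j : LinearMap.ker g →ₗ[R] LinearMap.ker (b ∘ₗ g) :=
    Submodule.inclusion (by rw [LinearMap.ker_comp]; exact Submodule.comap_mono bot_le)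
  refine torVanishes_of_exact (a := j) (b := q) (Submodule.inclusion_injective _) ?_ ?_ h h'
  · intro z
    rw [← ha.eq_iff, hq, map_zero]
    exact ⟨fun hz ↦ ⟨⟨z, hz⟩, rfl⟩, by rintro ⟨y, rfl⟩; exact y.2⟩
  · intro n
    obtain ⟨z, hz⟩ := hN.surjective (a n)
    have hz' : b (g z) = 0 := by rw [hz]; exact (hab _).2 ⟨n, rfl⟩
    exact ⟨⟨z, hz'⟩, ha ((hq _).trans hz)⟩

/-- By right exactness, $M\otimes N'\to M\otimes N\to M\otimes\operatorname{range} g\to0$ is always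
exact, so the only obstruction is the kernel of $M\otimes\operatorname{range} g\to M\otimes N''$. -/
theorem Function.Exact.lTensor_exact_iff_injective {f : N' →ₗ[R] N} {g : N →ₗ[R] N''}
    (hfg : Function.Exact f g) (M : Type*) [AddCommGroup M] [Module R M] :
    Function.Exact (f.lTensor M) (g.lTensor M) ↔
      Function.Injective ((LinearMap.range g).subtype.lTensor M) := by
  have hr : Function.Exact f g.rangeRestrict := by
    rw [LinearMap.exact_iff, LinearMap.ker_rangeRestrict, hfg.linearMap_ker_eq]
  have hs := g.surjective_rangeRestrict
  have he := lTensor_exact M hr hs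
  have hsM := LinearMap.lTensor_surjective M hs
  have hc (z) : g.lTensor M z =
      (LinearMap.range g).subtype.lTensor M (g.rangeRestrict.lTensor M z) := by
    rw [← LinearMap.comp_apply, ← LinearMap.lTensor_comp, LinearMap.subtype_comp_codRestrict]
  constructor
  · intro h
    rw [injective_iff_map_eq_zero]
    intro z hz
    obtain ⟨y, rfl⟩ := hsM z
    rw [← hc] at hz
    exact (he _).2 ((h _).1 hz)
  · intro h z
    rw [hc, ← he z, map_eq_zero_iff _ h]

theorem torVanishes_iff_of_resolution {X : ℕ → Type u} [∀ n, AddCommGroup (X n)]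
    [∀ n, Module R (X n)] [∀ n, Module.Flat R (X n)] (d : ∀ n, X (n + 1) →ₗ[R] X n)
    (p : X 0 →ₗ[R] N) (hd : ∀ n, Function.Exact (d (n + 1)) (d n)) (hp : Function.Exact (d 0) p)
    (hs : Function.Surjective p) (i : ℕ) :
    TorVanishes R M i N ↔ Function.Exact ((d (i + 1)).lTensor M) ((d i).lTensor M) := by
  have hpres (n : ℕ) : IsFlatPresentation (LinearMap.range (d (n + 1))).subtype (d n).rangeRestrict :=
    ⟨inferInstance, Subtype.val_injective, by
      rw [LinearMap.exact_iff, LinearMap.ker_rangeRestrict, (hd n).linearMap_ker_eq,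
        Submodule.range_subtype], (d n).surjective_rangeRestrict⟩
  have hpres0 : IsFlatPresentation (LinearMap.range (d 0)).subtype p :=
    ⟨inferInstance, Subtype.val_injective, by
      rw [LinearMap.exact_iff, hp.linearMap_ker_eq, Submodule.range_subtype], hs⟩
  rw [(hd i).lTensor_exact_iff_injective]
  have key (i n : ℕ) : TorVanishes R M i (LinearMap.range (d n)) ↔
      Function.Injective ((LinearMap.range (d (n + i + 1))).subtype.lTensor M) := by
    induction i generalizing n with
    | zero => exact (hpres n).torVanishes_zero_iff M
    | succ i ih =>
      rw [(hpres n).torVanishes_succ_iff M, ih, show n + 1 + i + 1 = n + (i + 1) + 1 by omega]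
  cases i with
  | zero => exact hpres0.torVanishes_zero_iff M
  | succ i => rw [hpres0.torVanishes_succ_iff M, key, zero_add]

end TorVanishes

theorem isZero_Tor_succ_iff_torVanishes (R : Type u) [CommRing R] (M N : ModuleCat.{u} R) (i : ℕ) :
    Limits.IsZero (((Tor (ModuleCat.{u} R) (i + 1)).obj M).obj N) ↔ TorVanishes R M i N := by
  let Q := projectiveResolution N
  have (n : ℕ) : Module.Flat R (Q.complex.X n) := by
    have : Module.Projective R (Q.complex.X n) :=
      (IsProjective.iff_projective (R := R) (Q.complex.X n)).2 (Q.projective n)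
    infer_instance
  let p : Q.complex.X 0 →ₗ[R] N := (Q.π.f 0).hom
  have hp : Function.Exact (Q.complex.d 1 0).hom p :=
    (ShortComplex.ShortExact.moduleCat_exact_iff_function_exact _).1 Q.exact₀
  have hs : Function.Surjective p := (ModuleCat.epi_iff_surjective (Q.π.f 0)).1 inferInstance
  rw [torVanishes_iff_of_resolution (X := fun n ↦ Q.complex.X n)
    (fun n ↦ (Q.complex.d (n + 1) n).hom) p
    (fun n ↦ (ShortComplex.ShortExact.moduleCat_exact_iff_function_exact _).1 (Q.exact_succ n))
    hp hs i]
  rw [Tor_obj, (Q.isoLeftDerivedObj _ (i + 1)).isZero_iff, HomologicalComplex.homologyFunctor_obj,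
    ← HomologicalComplex.exactAt_iff_isZero_homology,
    HomologicalComplex.exactAt_iff' _ (i + 2) (i + 1) i (by simp) (by simp)]
  exact ShortComplex.ShortExact.moduleCat_exact_iff_function_exact _

/-! ### Change of rings -/

open TensorProduct in
theorem IsFlatPresentation.baseChange {R K P N : Type u} [CommRing R] [AddCommGroup K]
    [AddCommGroup P] [AddCommGroup N] [Module R K] [Module R P] [Module R N] {f : K →ₗ[R] P}
    {g : P →ₗ[R] N} (h : IsFlatPresentation f g) (S : Type u) [CommRing S] [Algebra R S]
    (hN : TorVanishes R S 0 N) : IsFlatPresentation (f.baseChange S) (g.baseChange S) :=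
  have := h.flat
  ⟨inferInstance, (h.torVanishes_zero_iff S).1 hN, lTensor_exact S h.exact h.surjective,
    LinearMap.lTensor_surjective S h.surjective⟩

open TensorProduct in
theorem lTensor_baseChange_injective_iff {R K P : Type*} [CommRing R] [AddCommGroup K]
    [AddCommGroup P] [Module R K] [Module R P] (f : K →ₗ[R] P) (S M : Type*) [CommRing S]
    [Algebra R S] [AddCommGroup M] [Module R M] [Module S M] [IsScalarTower R S M] :
    Function.Injective ((f.baseChange S).lTensor M) ↔ Function.Injective (f.lTensor M) := by
  have hc : (f.lTensor M) ∘ (AlgebraTensorModule.cancelBaseChange R S S M K) =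
      (AlgebraTensorModule.cancelBaseChange R S S M P) ∘ ((f.baseChange S).lTensor M) := by
    have : (AlgebraTensorModule.lTensor S M f) ∘ₗ
        (AlgebraTensorModule.cancelBaseChange R S S M K).toLinearMap =
      (AlgebraTensorModule.cancelBaseChange R S S M P).toLinearMap ∘ₗ
        ((f.baseChange S).lTensor M) := by
      ext
      simp
    exact congrArg DFunLike.coe this
  rw [← EquivLike.injective_comp (AlgebraTensorModule.cancelBaseChange R S S M K), hc,
    EquivLike.comp_injective]

open TensorProduct in
theorem IsFlatPresentation.torVanishes_zero_baseChange_iff {R K P N : Type u} [CommRing R]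
    [AddCommGroup K] [AddCommGroup P] [AddCommGroup N] [Module R K] [Module R P] [Module R N]
    {f : K →ₗ[R] P} {g : P →ₗ[R] N} (h : IsFlatPresentation f g) (S M : Type u) [CommRing S]
    [Algebra R S] [AddCommGroup M] [Module R M] [Module S M] [IsScalarTower R S M]
    (hN : TorVanishes R S 0 N) : TorVanishes S M 0 (S ⊗[R] N) ↔ TorVanishes R M 0 N := by
  rw [h.torVanishes_zero_iff M, (h.baseChange S hN).torVanishes_zero_iff M]
  exact lTensor_baseChange_injective_iff f S M

-- Tor-independence of `S` and `K` keeps flat presentations exact after base change, and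
-- $M\otimes_S(S\otimes_R-)\cong M\otimes_R-$.
open TensorProduct in
theorem torVanishes_baseChange_iff {R : Type u} [CommRing R] (S M K : Type u) [CommRing S]
    [Algebra R S] [AddCommGroup M] [Module R M] [Module S M] [IsScalarTower R S M]
    [AddCommGroup K] [Module R K] (hK : ∀ j, TorVanishes R S j K) (i : ℕ) :
    TorVanishes S M i (S ⊗[R] K) ↔ TorVanishes R M i K := by
  have h := isFlatPresentation_tautological R K
  induction i generalizing K with
  | zero =>
    exact h.torVanishes_zero_baseChange_iff S M (hK 0)
  | succ i ih =>
    rw [h.torVanishes_succ_iff M, (h.baseChange S (hK 0)).torVanishes_succ_iff M]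
    exact ih _ (fun j ↦ (h.torVanishes_succ_iff S j).1 (hK (j + 1)))
      (isFlatPresentation_tautological R _)

/-! ### Finite projective dimension and Tor-persistence -/

theorem LinearMap.shortExact_of_exact {R K P N : Type u} [CommRing R] [AddCommGroup K]
    [AddCommGroup P] [AddCommGroup N] [Module R K] [Module R P] [Module R N]
    {f : K →ₗ[R] P} {g : P →ₗ[R] N} (hf : Function.Injective f) (hfg : Function.Exact f g)
    (hg : Function.Surjective g) :
    (ModuleCat.shortComplexOfCompEqZero f g hfg.linearMap_comp_eq_zero).ShortExact :=
  ModuleCat.shortComplex_shortExact _ hfg hf hg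

theorem hasProjectiveDimensionLE_succ_iff_of_exact {R K P N : Type u} [CommRing R] [AddCommGroup K]
    [AddCommGroup P] [AddCommGroup N] [Module R K] [Module R P] [Module R N] [Module.Projective R P]
    {f : K →ₗ[R] P} {g : P →ₗ[R] N} (hf : Function.Injective f) (hfg : Function.Exact f g)
    (hg : Function.Surjective g) (n : ℕ) :
    HasProjectiveDimensionLE (ModuleCat.of R N) (n + 1) ↔
      HasProjectiveDimensionLE (ModuleCat.of R K) n := by
  exact (LinearMap.shortExact_of_exact hf hfg hg).hasProjectiveDimensionLT_X₃_iff n inferInstance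

/-- `M` has finite projective dimension over `R`. -/
def HasFiniteProjectiveDimension (R M : Type u) [CommRing R] [AddCommGroup M] [Module R M] : Prop :=
  ∃ d : ℕ, HasProjectiveDimensionLE (ModuleCat.of R M) d

theorem hasFiniteProjectiveDimension_iff_of_exact {R K P N : Type u} [CommRing R] [AddCommGroup K]
    [AddCommGroup P] [AddCommGroup N] [Module R K] [Module R P] [Module R N] [Module.Projective R P]
    {f : K →ₗ[R] P} {g : P →ₗ[R] N} (hf : Function.Injective f) (hfg : Function.Exact f g)
    (hg : Function.Surjective g) :
    HasFiniteProjectiveDimension R N ↔ HasFiniteProjectiveDimension R K := by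
  constructor
  · rintro ⟨d, hd⟩
    have : HasProjectiveDimensionLE (ModuleCat.of R N) (d + 1) :=
      hasProjectiveDimensionLT_of_ge _ (d + 1) (d + 2) (by omega)
    exact ⟨d, (hasProjectiveDimensionLE_succ_iff_of_exact hf hfg hg d).1 this⟩
  · rintro ⟨d, hd⟩
    exact ⟨d + 1, (hasProjectiveDimensionLE_succ_iff_of_exact hf hfg hg d).2 hd⟩

/-- `Tor_i(M, M) = 0` for all `i ≫ 0`. -/
def EventuallySelfTorVanishes (R M : Type u) [CommRing R] [AddCommGroup M] [Module R M] : Prop :=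
  ∃ n : ℕ, ∀ i : ℕ, n ≤ i → TorVanishes R M i M

theorem isTorPersistent_iff (A : Type u) [CommRing A] :
    IsTorPersistent A ↔ ∀ (M : Type u) [AddCommGroup M] [Module A M] [Module.Finite A M],
      EventuallySelfTorVanishes A M → HasFiniteProjectiveDimension A M := by
  constructor
  · rintro h M _ _ _ ⟨n, hn⟩
    refine h (ModuleCat.of A M) ‹_› ⟨n + 1, fun i hi ↦ ?_⟩
    obtain ⟨i, rfl⟩ : ∃ j, i = j + 1 := ⟨i - 1, by omega⟩
    exact (isZero_Tor_succ_iff_torVanishes A _ _ i).2 (hn i (by omega))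
  · rintro h M _ ⟨n, hn⟩
    exact h M ⟨n, fun i hi ↦ (isZero_Tor_succ_iff_torVanishes A _ _ i).1 (hn (i + 1) (by omega))⟩

open TensorProduct in
/-- `B ⊗[A] M ≃ M` for a `B`-module `M`, when `A → B` is surjective. -/
noncomputable def tensorEquivOfSurjective {A B : Type*} [CommRing A] [CommRing B] [Algebra A B]
    (h : Function.Surjective (algebraMap A B)) (M : Type*) [AddCommGroup M] [Module A M]
    [Module B M] [IsScalarTower A B M] : B ⊗[A] M ≃ₗ[B] M :=
  have : CompatibleSMul A B B M := ⟨fun b x m ↦ by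
    obtain ⟨a, rfl⟩ := h b
    rw [algebraMap_smul, algebraMap_smul, smul_tmul]⟩
  (equivOfCompatibleSMul A B B B M).symm ≪≫ₗ TensorProduct.lid B M

open TensorProduct in
attribute [local instance] RingHomInvPair.of_ringEquiv in
theorem IsTorPersistent.of_ringEquiv {A B : Type u} [CommRing A] [CommRing B] (e : A ≃+* B)
    (h : IsTorPersistent A) : IsTorPersistent B := by
  rw [isTorPersistent_iff] at h ⊢
  rintro M _ _ _ ⟨n, hn⟩
  algebraize [e.toRingHom]
  let : Module A M := Module.compHom M e.toRingHom
  have : IsScalarTower A B M := ⟨fun a b m ↦ by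
    rw [Algebra.smul_def, mul_smul]; rfl⟩
  have hsurj : Function.Surjective (algebraMap A B) := e.surjective
  have : Module.Finite A B := Module.Finite.of_surjective (Algebra.linearMap A B) hsurj
  have : Module.Finite A M := Module.Finite.trans B M
  have : Module.Flat A B := Module.Flat.of_linearEquiv
    (LinearEquiv.ofBijective (Algebra.linearMap A B) e.bijective).symm
  let ε := tensorEquivOfSurjective hsurj M
  obtain ⟨d, hd⟩ := h M ⟨n, fun i hi ↦ by
    rw [← torVanishes_baseChange_iff B M M (fun j ↦ torVanishes_of_flat_left j),
      torVanishes_congr_right ε]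
    exact hn i hi⟩
  refine ⟨d, ?_⟩
  let e' : ModuleCat.of A M ≃ₛₗ[RingHomClass.toRingHom e] ModuleCat.of B M :=
    { AddEquiv.refl M with map_smul' := fun _ _ ↦ rfl }
  exact ModuleCat.hasProjectiveDimensionLE_of_semiLinearEquiv e e' d

/-! ### Ascent from the quotient by a regular element -/

/-- From $0\to R\xrightarrow{x}R\to R/x\to0$: $\operatorname{Tor}_1(R/x,K)$ is the $x$-torsion of
$K$, and the higher Tor vanish. -/
theorem torVanishes_quotient_span_singleton {R : Type u} [CommRing R] {x : R}
    (hx : IsSMulRegular R x) {K : Type u} [AddCommGroup K] [Module R K] (hK : IsSMulRegular K x)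
    (j : ℕ) : TorVanishes R (R ⧸ Ideal.span {x}) j K := by
  have h : IsFlatPresentation (LinearMap.lsmul R R x) (Submodule.mkQ (Ideal.span {x})) := by
    refine ⟨inferInstance, hx, ?_, Submodule.mkQ_surjective _⟩
    intro y
    rw [Submodule.mkQ_apply, Submodule.Quotient.mk_eq_zero, Ideal.mem_span_singleton']
    simp [mul_comm]
  cases j with
  | zero =>
    rw [h.torVanishes_zero_iff_rTensor K]
    have hc : TensorProduct.lid R K ∘ ((LinearMap.lsmul R R x).rTensor K) =
        (x • ·) ∘ TensorProduct.lid R K := by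
      have : (TensorProduct.lid R K).toLinearMap ∘ₗ ((LinearMap.lsmul R R x).rTensor K) =
          LinearMap.lsmul R K x ∘ₗ (TensorProduct.lid R K).toLinearMap := by
        ext
        simp
      exact congrArg DFunLike.coe this
    rw [← EquivLike.comp_injective _ (TensorProduct.lid R K), hc, EquivLike.injective_comp]
    exact hK
  | succ j =>
    rw [h.torVanishes_succ_iff_left K]
    exact torVanishes_of_flat_left j

open Pointwise in
theorem exact_lsmul_quotSMulTop {R : Type*} [CommRing R] (x : R) (K : Type*) [AddCommGroup K]
    [Module R K] : Function.Exact (LinearMap.lsmul R K x)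
      (Submodule.mkQ (x • (⊤ : Submodule R K))) := by
  intro y
  rw [Submodule.mkQ_apply, Submodule.Quotient.mk_eq_zero,
    Submodule.mem_smul_pointwise_iff_exists]
  simp

theorem isSMulRegular_ker {R P N : Type*} [CommRing R] [AddCommGroup P] [AddCommGroup N]
    [Module R P] [Module R N] {x : R} (hP : IsSMulRegular P x) (g : P →ₗ[R] N) :
    IsSMulRegular (LinearMap.ker g) x :=
  hP.submodule _ _

open IsLocalRing in
theorem isLocalRing_quotient_span_singleton {R : Type*} [CommRing R] [IsLocalRing R] {x : R}
    (hxm : x ∈ maximalIdeal R) :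
    IsLocalRing (R ⧸ Ideal.span {x}) :=
  have : Nontrivial (R ⧸ Ideal.span {x}) := Ideal.Quotient.nontrivial_iff.2
    (ne_top_of_le_ne_top (maximalIdeal.isMaximal R).ne_top
      ((Ideal.span_singleton_le_iff_mem _).2 hxm))
  IsLocalRing.of_surjective' _ Ideal.Quotient.mk_surjective

section Local

variable {R : Type u} [CommRing R] [IsNoetherianRing R] [IsLocalRing R] {x : R}

open IsLocalRing TensorProduct

/-- Syzygies commute with reduction mod $x$, so the induction ends at $K/xK$ free, where $K$ is free
because $x$ is $K$-regular and lies in the Jacobson radical. -/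
theorem hasFiniteProjectiveDimension_of_quotient (hx : IsSMulRegular R x)
    (hxm : x ∈ maximalIdeal R) (K : Type u) [AddCommGroup K] [Module R K] [Module.Finite R K]
    (hK : IsSMulRegular K x)
    (h : HasFiniteProjectiveDimension (R ⧸ Ideal.span {x}) ((R ⧸ Ideal.span {x}) ⊗[R] K)) :
    HasFiniteProjectiveDimension R K := by
  obtain ⟨d, hd⟩ := h
  induction d generalizing K with
  | zero =>
    have := isLocalRing_quotient_span_singleton hxm
    have : Module.Projective (R ⧸ Ideal.span {x}) ((R ⧸ Ideal.span {x}) ⊗[R] K) :=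
      (IsProjective.iff_projective _).2 ((projective_iff_hasProjectiveDimensionLE_zero _).2 hd)
    have : Module.Free (R ⧸ Ideal.span {x}) ((R ⧸ Ideal.span {x}) ⊗[R] K) :=
      Module.free_of_flat_of_isLocalRing
    have := Module.finitePresentation_of_finite R K
    have : Module.Free (R ⧸ Ideal.span {x}) (QuotSMulTop x K) :=
      Module.Free.of_equiv ((QuotSMulTop.equivQuotTensor x K).extendScalarsOfSurjective
        Ideal.Quotient.mk_surjective).symm
    have hfree : Module.Free R K := (Module.free_quotSMulTop_iff_free R K
      (maximalIdeal_le_jacobson _ hxm) hK).1 this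
    refine ⟨0, (projective_iff_hasProjectiveDimensionLE_zero _).1
      ((IsProjective.iff_projective _).1 (inferInstance : Module.Projective R K))⟩
  | succ d ih =>
    obtain ⟨n, f, hf⟩ := Module.Finite.exists_fin' R K
    have hpres := isFlatPresentation_ker hf
    have hpres' := hpres.baseChange (R ⧸ Ideal.span {x})
      (torVanishes_quotient_span_singleton hx hK 0)
    rw [hasFiniteProjectiveDimension_iff_of_exact hpres.injective hpres.exact hpres.surjective]
    exact ih _ (isSMulRegular_ker (IsSMulRegular.pi fun _ ↦ hx) f)
      ((hasProjectiveDimensionLE_succ_iff_of_exact hpres'.injective hpres'.exact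
        hpres'.surjective d).1 hd)

theorem IsTorPersistent.of_quotient_span_singleton (hx : IsSMulRegular R x)
    (hxm : x ∈ maximalIdeal R) (h : IsTorPersistent (R ⧸ Ideal.span {x})) :
    IsTorPersistent R := by
  rw [isTorPersistent_iff] at h ⊢
  rintro M _ _ _ ⟨N, hN⟩
  obtain ⟨n, f, hf⟩ := Module.Finite.exists_fin' R M
  have hpres := isFlatPresentation_ker hf
  rw [hasFiniteProjectiveDimension_iff_of_exact hpres.injective hpres.exact hpres.surjective]
  generalize hKdef : LinearMap.ker f = K at hpres ⊢
  have hK : IsSMulRegular K x := hKdef ▸ isSMulRegular_ker (IsSMulRegular.pi fun _ ↦ hx) f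
  -- Shifting in both arguments: $\operatorname{Tor}_{i+1}(K,K)$ is $\operatorname{Tor}_{i+3}(M,M)$.
  have hKK (i : ℕ) (hi : N ≤ i) : TorVanishes R K i K := by
    rw [← hpres.torVanishes_succ_iff_left K, ← hpres.torVanishes_succ_iff M]
    exact hN _ (by omega)
  refine hasFiniteProjectiveDimension_of_quotient hx hxm K hK (h _ ⟨N + 1, fun i hi ↦ ?_⟩)
  rw [torVanishes_baseChange_iff _ _ _ (torVanishes_quotient_span_singleton hx hK),
    torVanishes_comm, ← torVanishes_congr_right (QuotSMulTop.equivQuotTensor x K)]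
  obtain ⟨i, rfl⟩ : ∃ j, i = j + 1 := ⟨i - 1, by omega⟩
  exact torVanishes_succ_of_exact (a := LinearMap.lsmul R K x) hK (exact_lsmul_quotSMulTop x K) (Submodule.mkQ_surjective _)
    (hKK i (by omega)) (hKK (i + 1) (by omega))

end Local

/-! ### Descent to the quotient by a regular element outside $\mathfrak m^2$ -/

section Local

open IsLocalRing TensorProduct

theorem quotient_span_singleton_smul_eq_zero {R M : Type*} [CommRing R] (x : R) [AddCommGroup M]
    [Module R M] [Module (R ⧸ Ideal.span {x}) M] [IsScalarTower R (R ⧸ Ideal.span {x}) M] (m : M) :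
    x • m = 0 := by
  rw [← algebraMap_smul (R ⧸ Ideal.span {x}) x m, Ideal.Quotient.algebraMap_eq,
    Ideal.Quotient.eq_zero_iff_mem.2 (Ideal.mem_span_singleton_self x), zero_smul]

open Pointwise in
theorem one_tmul_eq_zero_iff_exists {R K : Type*} [CommRing R] (x : R) [AddCommGroup K]
    [Module R K] (k : K) :
    (1 : R ⧸ Ideal.span {x}) ⊗ₜ[R] k = 0 ↔ ∃ y : K, x • y = k := by
  have := LinearMap.ker_tensorProductMk (Q := K) (I := Ideal.span {x})
  rw [← TensorProduct.mk_apply, ← LinearMap.mem_ker, this, Submodule.ideal_span_singleton_smul,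
    Submodule.mem_smul_pointwise_iff_exists]
  simp

/-- Lift a basis of $M/\mathfrak mM$: Nakayama gives generation, and any relation reduces to the
trivial one. -/
theorem exists_minimal_generators {R : Type u} [CommRing R] [IsLocalRing R] (M : Type u) [AddCommGroup M] [Module R M]
    [Module.Finite R M] :
    ∃ (ι : Type u) (_ : Fintype ι) (v : ι → M), Submodule.span R (Set.range v) = ⊤ ∧
      ∀ c : ι → R, ∑ i, c i • v i = 0 → ∀ i, c i ∈ maximalIdeal R := by
  let w := Module.Free.chooseBasis (ResidueField R) (ResidueField R ⊗[R] M)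
  obtain ⟨v, hv⟩ := (TensorProduct.mk_surjective R M (ResidueField R)
    Ideal.Quotient.mk_surjective).comp_left w
  refine ⟨_, inferInstance, v, span_eq_top_of_tmul_eq_basis _ w (congr_fun hv), fun c hc i ↦ ?_⟩
  have h := congrArg (TensorProduct.mk R (ResidueField R) M 1) hc
  have hw : ∑ i, residue R (c i) • w i = 0 := by
    rw [map_zero, map_sum] at h
    rw [← h]
    refine Finset.sum_congr rfl fun i _ ↦ ?_
    rw [map_smul, ← hv]
    exact algebraMap_smul _ _ _
  rw [← residue_eq_zero_iff]
  exact Fintype.linearIndependent_iff.1 w.linearIndependent _ hw i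

variable {R : Type u} [CommRing R] [IsNoetherianRing R] [IsLocalRing R] {x : R}

/-- If $xc\in\mathfrak mK\subseteq\mathfrak m^2R^\iota$, then $x\notin\mathfrak m^2$ forces every
coordinate of $c$ into $\mathfrak m$. So multiplication by $x$, as a map $R^\iota\to K$, is
injective modulo $\mathfrak m$; comparing ranks makes it bijective there, and Nakayama makes it onto
$K$. -/
theorem surjective_smul_of_notMem_sq {ι : Type u} [Fintype ι] (hx2 : x ∉ maximalIdeal R ^ 2)
    (K : Submodule R (ι → R)) [Module.Free R K] (hK : ∀ c ∈ K, ∀ i, c i ∈ maximalIdeal R)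
    (hxK : ∀ p : ι → R, x • p ∈ K) :
    ∀ c ∈ K, ∃ p, x • p = c := by
  classical
  let θ : (ι → R) →ₗ[R] K := (LinearMap.lsmul R (ι → R) x).codRestrict K hxK
  have hinj : Function.Injective (θ.baseChange (ResidueField R)) := by
    rw [injective_iff_map_eq_zero]
    intro z hz
    obtain ⟨c, rfl⟩ := TensorProduct.mk_surjective R (ι → R) (ResidueField R)
      Ideal.Quotient.mk_surjective z
    rw [TensorProduct.mk_apply, LinearMap.baseChange_tmul, ← TensorProduct.mk_apply,
      ← LinearMap.mem_ker] at hz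
    replace hz : θ c ∈ maximalIdeal R • (⊤ : Submodule R K) := by
      rwa [← LinearMap.ker_tensorProductMk]
    have hmap := Submodule.mem_map_of_mem (f := K.subtype) hz
    rw [Submodule.map_smul'', Submodule.map_subtype_top] at hmap
    have hsq : ∀ i, x * c i ∈ maximalIdeal R ^ 2 := by
      refine Submodule.smul_induction_on (p := fun y ↦ ∀ i, y i ∈ maximalIdeal R ^ 2) hmap ?_ ?_
      · intro r hr n hn i
        rw [pow_two]
        exact Ideal.mul_mem_mul hr (hK n hn i)
      · intro y z hy hz i
        exact Ideal.add_mem _ (hy i) (hz i)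
    have hc : ∀ i, c i ∈ maximalIdeal R := by
      intro i
      by_contra hi
      rw [mem_maximalIdeal, mem_nonunits_iff, not_not] at hi
      exact hx2 ((Ideal.mul_unit_mem_iff_mem _ hi).1 (hsq i))
    have hcm : c ∈ maximalIdeal R • (⊤ : Submodule R (ι → R)) := by
      rw [pi_eq_sum_univ' c]
      exact Submodule.sum_mem _ fun i _ ↦ Submodule.smul_mem_smul (hc i) trivial
    rwa [← LinearMap.ker_tensorProductMk] at hcm
  have hle : Module.finrank R K ≤ Module.finrank R (ι → R) :=
    LinearMap.finrank_le_finrank_of_injective K.injective_subtype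
  have hge := LinearMap.finrank_le_finrank_of_injective hinj
  rw [Module.finrank_baseChange, Module.finrank_baseChange] at hge
  have hsurj : Function.Surjective (θ.baseChange (ResidueField R)) :=
    (LinearMap.injective_iff_surjective_of_finrank_eq_finrank (by
      rw [Module.finrank_baseChange, Module.finrank_baseChange]; omega)).1 hinj
  have hrange : LinearMap.range θ = ⊤ := by
    rw [← map_tensorProduct_mk_eq_top, eq_top_iff]
    rintro z -
    obtain ⟨z, rfl⟩ := hsurj z
    obtain ⟨c, rfl⟩ := TensorProduct.mk_surjective R (ι → R) (ResidueField R)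
      Ideal.Quotient.mk_surjective z
    exact ⟨θ c, ⟨c, rfl⟩, by simp⟩
  intro c hc
  obtain ⟨p, hp⟩ := LinearMap.range_eq_top.1 hrange ⟨c, hc⟩
  exact ⟨p, congrArg Subtype.val hp⟩

theorem free_quotient_of_hasProjectiveDimensionLE_one (hx2 : x ∉ maximalIdeal R ^ 2)
    (M : Type u) [AddCommGroup M] [Module R M] [Module (R ⧸ Ideal.span {x}) M]
    [IsScalarTower R (R ⧸ Ideal.span {x}) M] [Module.Finite R M]
    (h : HasProjectiveDimensionLE (ModuleCat.of R M) 1) : Module.Free (R ⧸ Ideal.span {x}) M := by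
  obtain ⟨ι, _, v, hspan, hmin⟩ := exists_minimal_generators (R := R) M
  let g := Fintype.linearCombination R v
  have hg : Function.Surjective g := by
    rw [← LinearMap.range_eq_top, Fintype.range_linearCombination, hspan]
  have hpres := isFlatPresentation_ker hg
  have hproj : Module.Projective R (LinearMap.ker g) :=
    (IsProjective.iff_projective _).2 ((projective_iff_hasProjectiveDimensionLE_zero _).2
      ((hasProjectiveDimensionLE_succ_iff_of_exact hpres.injective hpres.exact
        hpres.surjective 0).1 h))
  have hfree : Module.Free R (LinearMap.ker g) := Module.free_of_flat_of_isLocalRing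
  have key := surjective_smul_of_notMem_sq hx2 (LinearMap.ker g)
    (fun c hc ↦ hmin c (by rwa [LinearMap.mem_ker, Fintype.linearCombination_apply] at hc))
    (fun p ↦ by
      rw [LinearMap.mem_ker, map_smul, quotient_span_singleton_smul_eq_zero])
  -- The relation module is $xR^\iota$, so the minimal generators form a basis over $R/x$.
  refine Module.Free.of_basis (Module.Basis.mk (v := v) ?_ ?_)
  · rw [Fintype.linearIndependent_iff]
    intro s hs i
    obtain ⟨r, rfl⟩ := (Ideal.Quotient.mk_surjective (I := Ideal.span {x})).comp_left s
    obtain ⟨p, rfl⟩ := key r (by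
      rw [LinearMap.mem_ker, Fintype.linearCombination_apply, ← hs]
      exact Finset.sum_congr rfl fun i _ ↦ (algebraMap_smul (R ⧸ Ideal.span {x}) (r i) (v i)).symm)
    exact Ideal.Quotient.eq_zero_iff_mem.2
      (Ideal.mul_mem_right _ _ (Ideal.mem_span_singleton_self x))
  · rintro m -
    exact Submodule.span_le_restrictScalars R (R ⧸ Ideal.span {x}) _
      (hspan ▸ Submodule.mem_top : m ∈ Submodule.span R (Set.range v))

theorem hasProjectiveDimensionLE_one_pi_quotient {R : Type u} [CommRing R] {x : R}
    (hx : IsSMulRegular R x) (n : ℕ) :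
    HasProjectiveDimensionLE (ModuleCat.of R (Fin n → R ⧸ Ideal.span {x})) 1 := by
  refine (hasProjectiveDimensionLE_succ_iff_of_exact (f := LinearMap.lsmul R (Fin n → R) x)
    (g := (Submodule.mkQ (Ideal.span {x})).compLeft (Fin n)) (IsSMulRegular.pi fun _ ↦ hx) ?_
    (Submodule.mkQ_surjective _).comp_left 0).2 ((projective_iff_hasProjectiveDimensionLE_zero _).1
      ((IsProjective.iff_projective _).1 (inferInstance : Module.Projective R (Fin n → R))))
  intro c
  constructor
  · intro hc
    have (i : Fin n) : ∃ a, a * x = c i := Ideal.mem_span_singleton'.1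
      ((Submodule.Quotient.mk_eq_zero _).1 (congrFun hc i))
    choose a ha using this
    exact ⟨a, funext fun i ↦ (mul_comm _ _).trans (ha i)⟩
  · rintro ⟨a, rfl⟩
    exact funext fun i ↦ (Submodule.Quotient.mk_eq_zero _).2
      (Ideal.mul_mem_right _ _ (Ideal.mem_span_singleton_self x))

theorem hasFiniteProjectiveDimension_quotient (hx : IsSMulRegular R x) (hx2 : x ∉ maximalIdeal R ^ 2)
    (M : Type u) [AddCommGroup M] [Module R M] [Module (R ⧸ Ideal.span {x}) M]
    [IsScalarTower R (R ⧸ Ideal.span {x}) M] [Module.Finite (R ⧸ Ideal.span {x}) M]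
    (h : HasFiniteProjectiveDimension R M) :
    HasFiniteProjectiveDimension (R ⧸ Ideal.span {x}) M := by
  obtain ⟨d, hd⟩ := h
  -- The induction must start at dimension 1, since a nonzero free $S$-module has $R$-dimension 1,
  -- not 0.
  replace hd : HasProjectiveDimensionLE (ModuleCat.of R M) (d + 1) :=
    hasProjectiveDimensionLT_of_ge _ (d + 1) (d + 2) (by omega)
  induction d generalizing M with
  | zero =>
    have : Module.Finite R M := Module.Finite.trans (R ⧸ Ideal.span {x}) M
    have := free_quotient_of_hasProjectiveDimensionLE_one hx2 M hd
    exact ⟨0, (projective_iff_hasProjectiveDimensionLE_zero _).1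
      ((IsProjective.iff_projective _).1
        (inferInstance : Module.Projective (R ⧸ Ideal.span {x}) M))⟩
  | succ d ih =>
    obtain ⟨n, f, hf⟩ := Module.Finite.exists_fin' (R ⧸ Ideal.span {x}) M
    have hpres := isFlatPresentation_ker hf
    rw [hasFiniteProjectiveDimension_iff_of_exact hpres.injective hpres.exact hpres.surjective]
    refine ih _ ?_
    have hS := LinearMap.shortExact_of_exact (R := R)
      (f := (LinearMap.ker f).subtype.restrictScalars R) (g := f.restrictScalars R)
      hpres.injective hpres.exact hpres.surjective
    have := hasProjectiveDimensionLE_one_pi_quotient hx n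
    -- $S^n$ has $R$-dimension at most 1, so an $S$-syzygy lowers the $R$-dimension bound by one
    -- while it exceeds 1.
    exact hS.hasProjectiveDimensionLT_X₁ (d + 2) (hasProjectiveDimensionLT_of_ge _ 2 _ (by omega)) hd

/-- With $K=\ker f$, $\operatorname{Tor}^R_{i+2}(M,N)$ is $\operatorname{Tor}^S_{i+1}(M,K/xK)$. The
latter lies between $\operatorname{Tor}^S_{i+1}(M,N)$ and $\operatorname{Tor}^S_{i+2}(M,N)$, via
$0\to N\to K/xK\to\Omega_SN\to0$. -/
theorem torVanishes_succ_of_quotient_of_surjective {R : Type u} [CommRing R] {x : R}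
    (hx : IsSMulRegular R x) (M : Type u) {N P : Type u} [AddCommGroup M] [Module R M] [Module (R ⧸ Ideal.span {x}) M]
    [IsScalarTower R (R ⧸ Ideal.span {x}) M]
    [AddCommGroup N] [Module R N] [Module (R ⧸ Ideal.span {x}) N]
    [IsScalarTower R (R ⧸ Ideal.span {x}) N] [AddCommGroup P] [Module R P] [Module.Flat R P]
    (hP : IsSMulRegular P x) {f : P →ₗ[R] N} (hf : Function.Surjective f) {i : ℕ}
    (h : TorVanishes (R ⧸ Ideal.span {x}) M i N)
    (h' : TorVanishes (R ⧸ Ideal.span {x}) M (i + 1) N) : TorVanishes R M (i + 1) N := by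
  let S := R ⧸ Ideal.span {x}
  have hsurj : Function.Surjective (algebraMap R S) := Ideal.Quotient.mk_surjective
  have hpres := isFlatPresentation_ker hf
  have hK : IsSMulRegular (LinearMap.ker f) x := isSMulRegular_ker hP f
  rw [hpres.torVanishes_succ_iff M,
    ← torVanishes_baseChange_iff S M _ (torVanishes_quotient_span_singleton hx hK)]
  let g : S ⊗[R] P →ₗ[S] N :=
    (tensorEquivOfSurjective hsurj N).toLinearMap ∘ₗ f.baseChange S
  have hg : Function.Surjective g :=
    (tensorEquivOfSurjective hsurj N).surjective.comp (LinearMap.lTensor_surjective S hf)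
  have hgpres := isFlatPresentation_ker hg
  rw [hgpres.torVanishes_succ_iff M] at h'
  let ι : S ⊗[R] LinearMap.ker f →ₗ[S] S ⊗[R] P :=
    (LinearMap.ker f).subtype.baseChange S
  have hι : Function.Exact ι (f.baseChange S) := lTensor_exact S hpres.exact hf
  have hker : LinearMap.ker g = LinearMap.range ι := by
    rw [LinearEquiv.ker_comp, hι.linearMap_ker_eq]
  let ψ : S ⊗[R] LinearMap.ker f →ₗ[S] LinearMap.ker g :=
    ι.codRestrict _ fun z ↦ hker ▸ LinearMap.mem_range_self ι z
  have hψ : Function.Surjective ψ := by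
    rintro ⟨z, hz⟩
    obtain ⟨y, rfl⟩ : z ∈ LinearMap.range ι := hker ▸ hz
    exact ⟨y, rfl⟩
  have hmem (p : P) : x • p ∈ LinearMap.ker f := by
    rw [LinearMap.mem_ker, map_smul, quotient_span_singleton_smul_eq_zero]
  -- The map $p\mapsto xp$ into $K/xK$ has kernel $K$ because $x$ is $P$-regular; it therefore
  -- induces the injection `φ` from $N\cong P/K$.
  let q : P →ₗ[R] S ⊗[R] LinearMap.ker f :=
    TensorProduct.mk R S (LinearMap.ker f) 1 ∘ₗ
      (LinearMap.lsmul R P x).codRestrict _ hmem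
  have hq (p) : q p = 0 ↔ f p = 0 := by
    change (1 : S) ⊗ₜ[R] (⟨x • p, hmem p⟩ : LinearMap.ker f) = 0 ↔ _
    rw [one_tmul_eq_zero_iff_exists]
    constructor
    · rintro ⟨y, hy⟩
      rw [← hP (congrArg Subtype.val hy : x • (y : P) = x • p)]
      exact y.2
    · intro hp
      exact ⟨⟨p, hp⟩, rfl⟩
  have hle : LinearMap.ker f ≤ LinearMap.ker q := fun p hp ↦ (hq p).2 hp
  let φ₀ : N →ₗ[R] S ⊗[R] LinearMap.ker f :=
    (LinearMap.ker f).liftQ q hle ∘ₗ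
      (f.quotKerEquivOfSurjective hf).symm.toLinearMap
  let φ : N →ₗ[S] S ⊗[R] LinearMap.ker f := φ₀.extendScalarsOfSurjective hsurj
  have hφ (p) : φ (f p) = q p := by
    change (LinearMap.ker f).liftQ q hle ((f.quotKerEquivOfSurjective hf).symm (f p)) = _
    have : (f.quotKerEquivOfSurjective hf).symm (f p) = Submodule.Quotient.mk p := by
      rw [LinearEquiv.symm_apply_eq]
      rfl
    rw [this, Submodule.liftQ_apply]
  refine torVanishes_of_exact (a := φ) (b := ψ) ?_ ?_ hψ h h'
  · rw [injective_iff_map_eq_zero]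
    intro n hn
    obtain ⟨p, rfl⟩ := hf n
    rwa [hφ, hq] at hn
  · intro z
    obtain ⟨k, rfl⟩ := TensorProduct.mk_surjective R (LinearMap.ker f) S hsurj z
    have h0 (k) : ψ (TensorProduct.mk R S (LinearMap.ker f) 1 k) = 0 ↔
        ∃ p : P, x • p = k := by
      rw [← one_tmul_eq_zero_iff_exists, ← Submodule.coe_eq_zero]
      rfl
    rw [h0]
    constructor
    · rintro ⟨p, hp⟩
      refine ⟨f p, ?_⟩
      rw [hφ]
      exact congrArg (TensorProduct.mk R S (LinearMap.ker f) 1) (Subtype.ext hp)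
    · rintro ⟨n, hn⟩
      obtain ⟨p, rfl⟩ := hf n
      rw [hφ] at hn
      rw [← h0, ← hn]
      exact (h0 ⟨x • p, hmem p⟩).2 ⟨p, rfl⟩

theorem IsTorPersistent.quotient_span_singleton (hx : IsSMulRegular R x) (hx2 : x ∉ maximalIdeal R ^ 2) (h : IsTorPersistent R) :
    IsTorPersistent (R ⧸ Ideal.span {x}) := by
  rw [isTorPersistent_iff] at h ⊢
  rintro M _ _ _ ⟨N, hN⟩
  let : Module R M := Module.compHom M (algebraMap R (R ⧸ Ideal.span {x}))
  have : IsScalarTower R (R ⧸ Ideal.span {x}) M := ⟨fun a b m ↦ by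
    rw [Algebra.smul_def, mul_smul]; rfl⟩
  have : Module.Finite R M := Module.Finite.trans (R ⧸ Ideal.span {x}) M
  refine hasFiniteProjectiveDimension_quotient hx hx2 M (h M ⟨N + 1, fun i hi ↦ ?_⟩)
  obtain ⟨i, rfl⟩ : ∃ j, i = j + 1 := ⟨i - 1, by omega⟩
  exact torVanishes_succ_of_quotient_of_surjective hx M (IsSMulRegular.finsupp hx)
    (Finsupp.linearCombination_id_surjective R M) (hN i (by omega)) (hN (i + 1) (by omega))

end Local

/-! ### Induction along the regular sequence -/

open IsLocalRing RingTheory.Sequence in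
theorem mem_maximalIdeal_of_isRegular_cons {R : Type u} [CommRing R] [IsLocalRing R] {x : R}
    {xs : List R} (h : IsRegular R (x :: xs)) : x ∈ maximalIdeal R := by
  refine le_maximalIdeal (J := Ideal.ofList (x :: xs)) (fun hJ ↦ h.top_ne_smul ?_)
    (Ideal.subset_span List.mem_cons_self)
  rw [hJ, Submodule.top_smul]

open RingTheory.Sequence in
theorem isRegular_quotient_of_isRegular_cons {R : Type u} [CommRing R] {x : R} {xs : List R}
    (h : IsRegular R (x :: xs)) :
    IsRegular (R ⧸ Ideal.span {x}) (xs.map (Ideal.Quotient.mk (Ideal.span {x}))) := by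
  have e : QuotSMulTop x R ≃ₗ[R] R ⧸ Ideal.span {x} :=
    Submodule.quotEquivOfEq _ _ (by
      rw [← Submodule.ideal_span_singleton_smul, smul_eq_mul, Ideal.mul_top])
  exact ((e.extendScalarsOfSurjective Ideal.Quotient.mk_surjective).isRegular_congr _).1
    ((isRegular_cons_iff' R x xs).1 h).2

/-- `(R ⧸ x) ⧸ xs ≃ R ⧸ (x :: xs)`. -/
noncomputable def quotientOfListConsEquiv {R : Type u} [CommRing R] (x : R) (xs : List R) :
    ((R ⧸ Ideal.span {x}) ⧸ Ideal.ofList (xs.map (Ideal.Quotient.mk (Ideal.span {x})))) ≃+*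
      R ⧸ Ideal.ofList (x :: xs) :=
  (Ideal.quotEquivOfEq (Ideal.map_ofList _ xs).symm).trans
    ((DoubleQuot.quotQuotEquivQuotSup _ _).trans (Ideal.quotEquivOfEq (Ideal.ofList_cons x xs).symm))

theorem IsLocalRing.maximalIdeal_le_map_of_surjective {R S : Type*} [CommRing R] [CommRing S]
    [IsLocalRing R] [IsLocalRing S] {f : R →+* S} (hf : Function.Surjective f) :
    maximalIdeal S ≤ (maximalIdeal R).map f := by
  intro s hs
  obtain ⟨r, rfl⟩ := hf s
  exact Ideal.mem_map_of_mem f fun hr ↦ hs (hr.map f)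

theorem proposition2p2 (R : Type u) [CommRing R] [IsNoetherianRing R] [IsLocalRing R]
    (xs : List R) (hxs : RingTheory.Sequence.IsRegular R xs) :
    (IsTorPersistent (R ⧸ Ideal.ofList xs) → IsTorPersistent R) ∧
      ((∀ (i : ℕ) (hi : i < xs.length),
          xs[i] ∉ IsLocalRing.maximalIdeal R ^ 2 ⊔ Ideal.ofList (xs.take i)) →
        IsTorPersistent R → IsTorPersistent (R ⧸ Ideal.ofList xs)) := by
  obtain ⟨n, hn⟩ : ∃ n, xs.length = n := ⟨_, rfl⟩
  induction n generalizing R xs with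
  | zero =>
    obtain rfl := List.length_eq_zero_iff.1 hn
    let e : R ⧸ Ideal.ofList ([] : List R) ≃+* R :=
      (Ideal.quotEquivOfEq Ideal.ofList_nil).trans (RingEquiv.quotientBot R)
    exact ⟨IsTorPersistent.of_ringEquiv e, fun _ ↦ IsTorPersistent.of_ringEquiv e.symm⟩
  | succ n ih =>
    obtain _ | ⟨x, xs⟩ := xs
    · simp at hn
    have hxm := mem_maximalIdeal_of_isRegular_cons hxs
    have hx : IsSMulRegular R x := ((RingTheory.Sequence.isRegular_cons_iff R x xs).1 hxs).1
    have := isLocalRing_quotient_span_singleton hxm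
    obtain ⟨h₁, h₂⟩ := ih (R ⧸ Ideal.span {x}) _ (isRegular_quotient_of_isRegular_cons hxs)
      (by simpa using hn)
    let e := quotientOfListConsEquiv x xs
    refine ⟨fun h ↦ .of_quotient_span_singleton hx hxm (h₁ (.of_ringEquiv e.symm h)),
      fun hm h ↦ .of_ringEquiv e (h₂ (fun i hi hmem ↦ ?_) (.quotient_span_singleton hx ?_ h))⟩
    · refine hm (i + 1) (by simpa using hi) ?_
      rw [List.getElem_map] at hmem
      -- Every ideal in the condition over $R/x$ is the image of one over $R$, so membership pulls
      -- back at the cost of adding $(x)$.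
      have hle : IsLocalRing.maximalIdeal (R ⧸ Ideal.span {x}) ^ 2 ⊔
          Ideal.ofList ((xs.map (Ideal.Quotient.mk (Ideal.span {x}))).take i) ≤
          (IsLocalRing.maximalIdeal R ^ 2 ⊔ Ideal.ofList (xs.take i)).map
            (Ideal.Quotient.mk (Ideal.span {x})) := by
        rw [Ideal.map_sup, Ideal.map_pow, Ideal.map_ofList, List.map_take]
        exact sup_le_sup_right
          (Ideal.pow_right_mono
            (IsLocalRing.maximalIdeal_le_map_of_surjective Ideal.Quotient.mk_surjective) 2) _
      have := Ideal.mem_comap.2 (hle hmem)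
      rw [Ideal.comap_map_of_surjective' _ Ideal.Quotient.mk_surjective, Ideal.mk_ker] at this
      rw [List.getElem_cons_succ, List.take_succ_cons, Ideal.ofList_cons]
      rwa [sup_comm (Ideal.span {x}), ← sup_assoc]
    · have := hm 0 (by simp)
      rwa [List.take_zero, Ideal.ofList_nil, sup_bot_eq] at this
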